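/- There are absolute constants $c, C > 0$ and $k \in \mathbb{N}$, and for every $n \in \mathbb{N}$ and $\epsilon \in (0, 1/2)$ a number of queries $q = q(n,\epsilon) \in \mathbb{N}$, a tolerance $\tau = \tau(n,\epsilon) > 0$ and a deterministic correlational statistical query algorithm $A = A_{n,\epsilon}$ with $$\max(q, 1/\tau) \;\le\; 2^{\,C\, t \log^k(2 + t)}, \qquad t = n^{1/2} \log(1/\epsilon),$$ that is, $\max(q, 1/\tau) = 2^{\tilde O(n^{1/2} \log(1/\epsilon))}$, such that the following holds. The algorithm $A$ makes at most $q$ queries to the oracle, whatever the answers are. Let $D$ be any distribution on $\{0,1\}^n \times \{0,1\}$ for which there is a monotone disjunction $f(\mathbf{x}) = \bigvee_{i \in S} \mathbf{x}_i$, $S \subseteq \{1, \dots, n\}$, with $$\Pr_{(\mathbf{x},y) \sim D}[f(\mathbf{x}) \ne y] \le 1/2 - \epsilon.$$ Then $A$, run with the oracle $\mathrm{CSTAT}_D(\tau)$, always (with certainty, for every choice of legal oracle answers) outputs a hypothesis $h : \{0,1\}^n \to \{0,1\}$ with $$\Pr_{(\mathbf{x},y) \sim D}[h(\mathbf{x})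 \ne y] \le 1/2 - c\,\epsilon .$$ Here $\mathrm{CSTAT}_D(\tau)$ answers a query, which is a function $\varphi : \{0,1\}^n \to [-1,1]$, with some value $v \in [-1,1]$ such that $|v - \mathbf{E}_{(\mathbf{x},y) \sim D}[(2y-1)\varphi(\mathbf{x})]| \le \tau$. A deterministic correlational statistical query algorithm is an adaptive query procedure (a decision tree whose nodes are queries, whose branches are the possible answers, and whose leaves are hypotheses); its complexity is measured by $q$ and $\tau$. -/

import Mathlib

/-- Points of the Boolean cube `{0,1}^n`, with `true` for `1` and `false` for `0`. -/
abbrev Cube (n : ℕ) : Type := Fin n → Bool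

/-- The monotone disjunction `x ↦ ⋁_{i ∈ S} x_i`; it is constantly `0` for `S = ∅`. -/
def monotoneDisjunction {n : ℕ} (S : Finset (Fin n)) (x : Cube n) : Bool :=
  decide (∃ i ∈ S, x i = true)

/-- The expectation `E_{(x,y) ∼ D}[g(x,y)]` under a distribution `D` on `{0,1}^n × {0,1}`. -/
noncomputable def expectation {n : ℕ} (D : PMF (Cube n × Bool)) (g : Cube n → Bool → ℝ) : ℝ :=
  ∑ z : Cube n × Bool, (D z).toReal * g z.1 z.2

/-- The misclassification error `Pr_{(x,y) ∼ D}[h(x) ≠ y]`. -/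
noncomputable def misclassError {n : ℕ} (D : PMF (Cube n × Bool)) (h : Cube n → Bool) : ℝ :=
  expectation D (fun x y => if h x ≠ y then 1 else 0)

/-- The real number `2y - 1` for a label `y ∈ {0,1}`. -/
def signedLabel (y : Bool) : ℝ := 2 * (if y = true then 1 else 0) - 1

/-- The value `E_{(x,y) ∼ D}[(2y-1) φ(x)]` that a correlational statistical query `φ` asks for. -/
noncomputable def correlation {n : ℕ} (D : PMF (Cube n × Bool))
    (φ : Cube n → Set.Icc (-1 : ℝ) 1) : ℝ :=
  expectation D (fun x y => signedLabel y * (φ x : ℝ))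

/-- `IsCSTATAnswer D τ φ v`: the oracle `CSTAT_D(τ)` may answer the query `φ` with the
value `v ∈ [-1,1]`. -/
def IsCSTATAnswer {n : ℕ} (D : PMF (Cube n × Bool)) (τ : ℝ)
    (φ : Cube n → Set.Icc (-1 : ℝ) 1) (v : Set.Icc (-1 : ℝ) 1) : Prop :=
  |(v : ℝ) - correlation D φ| ≤ τ

/-- Deterministic correlational statistical query algorithms on `{0,1}^n`: such an algorithm
either stops and outputs a hypothesis `h : {0,1}^n → {0,1}`, or it asks a query
`φ : {0,1}^n → [-1,1]` and continues in a way that depends on the answer in `[-1,1]`.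
The queries may thus be adaptive. -/
inductive CSQAlgorithm (n : ℕ) : Type where
  | output (h : Cube n → Bool) : CSQAlgorithm n
  | query (φ : Cube n → Set.Icc (-1 : ℝ) 1)
      (next : Set.Icc (-1 : ℝ) 1 → CSQAlgorithm n) : CSQAlgorithm n

namespace CSQAlgorithm

/-- `A.MakesAtMost q`: whatever the answers are, `A` asks at most `q` queries. -/
def MakesAtMost {n : ℕ} : CSQAlgorithm n → ℕ → Prop
  | output _, _ => True
  | query _ _, 0 => False
  | query _ next, q + 1 => ∀ v, (next v).MakesAtMost q

/-- `A.CanReturn D τ h`: there are answers that are legal for the oracle `CSTAT_D(τ)` and on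
which `A` outputs `h`. The oracle may be adversarial: it is free to choose any legal answer,
depending on the whole history of the run. -/
def CanReturn {n : ℕ} (D : PMF (Cube n × Bool)) (τ : ℝ) :
    CSQAlgorithm n → (Cube n → Bool) → Prop
  | output g, h => g = h
  | query φ next, h => ∃ v, IsCSTATAnswer D τ φ v ∧ (next v).CanReturn D τ h

end CSQAlgorithm

/-- The function `t · (log (2 + t))^k`; a quantity is `Õ(t)` if it is at most a constant multiple
of this one for some constant `k`. The shift by `2` keeps the logarithm away from `0` for
bounded `t`. -/
noncomputable def timesPolylog (k : ℕ) (t : ℝ) : ℝ := t * Real.log (2 + t) ^ k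

/-!
The learner estimates the correlation of *every* monotone disjunction with the label from the
correlations of the monomials `∏_{i ∈ T} x_i` of low degree, and outputs the disjunction whose
estimate is largest.

For `n ≥ 1` let `a = T_r(1 + 1/n)` for the Chebyshev polynomial `T_r` with `r = ⌈√n⌉`. Then
`a ≥ 1 + r²/n ≥ 2`, while `|T_r| ≤ 1` on `[-1, 1]`. Hence
`P(z) = 1 - 2 (T_r(1 + (1 - z)/n) / a)^K` has degree at most `rK`, satisfies `P(0) = -1`, and is
within `2 · 2^{-K}` of `1` at the integers `1, …, n` (`exists_polynomial_approx_sign`). So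
`x ↦ P(#{i ∈ S | x_i = 1})` approximates the `±1`-valued disjunction over `S` on the whole cube,
with error at most `ε/4` once `2^K ≥ 8/ε`. By the Gregory-Newton formula it is a combination of
the monomials over the sets `T ⊆ S` with `#T ≤ d = rK`, the coefficient being the iterated forward
difference of `P` at `0` of order `#T`, which is at most `3 · 2^d` in absolute value because it
only involves the values of `P` at `0, …, n`
(`exists_monomial_expansion_approx_disjunction`).

There are at most `(n + 1)^d` monomials, so answers of tolerance `2^{-O(d log n)} ε` give every
disjunction's correlation up to `ε/2`. A disjunction of error at most `1/2 - ε` has correlation at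
least `2ε`; the one with the largest estimate then has correlation at least `ε`, that is, error at
most `1/2 - ε/2`. Since `d = O(√n log(1/ε))`, both complexity measures are within the bound.
-/

open Finset Polynomial

section Approximation

/-! ### Polynomial approximation of a disjunction -/

theorem one_add_sq_mul_le_eval_chebyshev_T {δ : ℝ} (hδ : 0 ≤ δ) (r : ℕ) :
    1 + (r : ℝ) ^ 2 * δ ≤ (Chebyshev.T ℝ r).eval (1 + δ) := by
  -- The increments grow by `2δ T_{k+1} ≥ 2δ` at each step of the three-term recurrence.
  suffices h : 1 + (r : ℝ) ^ 2 * δ ≤ (Chebyshev.T ℝ r).eval (1 + δ) ∧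
      (2 * r + 1) * δ ≤
        (Chebyshev.T ℝ ((r : ℤ) + 1)).eval (1 + δ) - (Chebyshev.T ℝ r).eval (1 + δ) from h.1
  induction r with
  | zero => simp
  | succ k ih =>
    obtain ⟨h₁, h₂⟩ := ih
    have hrec : (Chebyshev.T ℝ ((k : ℤ) + 2)).eval (1 + δ) =
        2 * (1 + δ) * (Chebyshev.T ℝ ((k : ℤ) + 1)).eval (1 + δ) -
          (Chebyshev.T ℝ k).eval (1 + δ) := by
      rw [Chebyshev.T_add_two]
      simp
    have h₃ : 1 + ((k : ℝ) + 1) ^ 2 * δ ≤ (Chebyshev.T ℝ ((k : ℤ) + 1)).eval (1 + δ) := by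
      linarith
    have h₄ : 1 ≤ (Chebyshev.T ℝ ((k : ℤ) + 1)).eval (1 + δ) :=
      le_trans (le_add_of_nonneg_right (by positivity)) h₃
    have h₅ := mul_le_mul_of_nonneg_left h₄ hδ
    push_cast
    refine ⟨h₃, ?_⟩
    rw [add_assoc, one_add_one_eq_two, hrec]
    linarith

/-- Amplification by the `K`-th power makes the error exponentially small in `K`, at the price of
a factor `K` in the degree. -/
theorem exists_polynomial_approx_sign {n r : ℕ} (hn : 0 < n) (hr : n ≤ r ^ 2) (K : ℕ) :
    ∃ P : ℝ[X], P.natDegree ≤ r * K ∧ P.eval 0 = -1 ∧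
      ∀ m : ℕ, 1 ≤ m → m ≤ n → |P.eval (m : ℝ) - 1| ≤ 2 * (1 / 2) ^ K := by
  have hn' : (0 : ℝ) < n := by exact_mod_cast hn
  have hr' : (n : ℝ) ≤ (r : ℝ) ^ 2 := by exact_mod_cast hr
  set a : ℝ := (Chebyshev.T ℝ r).eval (1 + 1 / (n : ℝ)) with ha
  have ha2 : 2 ≤ a := by
    have h₁ := one_add_sq_mul_le_eval_chebyshev_T (δ := 1 / (n : ℝ)) (by positivity) r
    have h₂ : 1 ≤ (r : ℝ) ^ 2 * (1 / (n : ℝ)) := by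
      rw [mul_one_div]
      exact (one_le_div hn').2 hr'
    linarith
  have ha0 : 0 < a := by linarith
  refine ⟨1 - C (2 / a ^ K) *
    ((Chebyshev.T ℝ r).comp (C (1 + 1 / (n : ℝ)) - C (1 / (n : ℝ)) * X)) ^ K, ?_, ?_, ?_⟩
  · refine (natDegree_sub_le _ _).trans (max_le (by simp) ?_)
    refine (natDegree_C_mul_le _ _).trans (natDegree_pow_le.trans ?_)
    rw [mul_comm r]
    refine Nat.mul_le_mul_left _ (natDegree_comp_le.trans ?_)
    rw [Chebyshev.natDegree_T, Int.natAbs_natCast]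
    refine (Nat.mul_le_mul_left r ?_).trans_eq (mul_one r)
    refine (natDegree_sub_le _ _).trans (max_le (by simp) ?_)
    exact (natDegree_C_mul_le _ _).trans natDegree_X_le
  · have hak : a ^ K ≠ 0 := by positivity
    simp only [eval_sub, eval_one, eval_mul, eval_C, eval_pow, eval_comp, eval_X, mul_zero,
      sub_zero, ← ha]
    field_simp
    norm_num
  · intro m h1 hmn
    have h1' : (1 : ℝ) ≤ m := by exact_mod_cast h1
    have hmn' : (m : ℝ) ≤ n := by exact_mod_cast hmn
    set u : ℝ := 1 + 1 / (n : ℝ) - 1 / (n : ℝ) * m with hu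
    have hu' : u = 1 - ((m : ℝ) - 1) / n := by rw [hu]; ring
    have hu1 : |u| ≤ 1 := by
      have h₁ : 0 ≤ ((m : ℝ) - 1) / n := div_nonneg (by linarith) hn'.le
      have h₂ : ((m : ℝ) - 1) / n ≤ 1 := (div_le_one hn').2 (by linarith)
      rw [hu', abs_le]
      constructor <;> linarith
    have hT := Chebyshev.abs_eval_T_real_le_one r hu1
    simp only [eval_sub, eval_one, eval_mul, eval_C, eval_pow, eval_comp, eval_X, ← hu]
    rw [sub_sub_cancel_left, abs_neg, abs_mul, abs_div, abs_pow, abs_pow, abs_two, abs_of_pos ha0,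
      div_mul_eq_mul_div, mul_div_assoc, ← div_pow]
    gcongr

/-- The **Gregory-Newton formula** as a sum over subsets. -/
theorem eval_card_eq_sum_powerset_fwdDiff {α : Type*} (P : ℝ[X]) (s : Finset α) :
    P.eval (#s : ℝ) = ∑ T ∈ s.powerset, (fwdDiff (1 : ℝ))^[#T] P.eval 0 := by
  rw [Finset.sum_powerset_apply_card (fun j => (fwdDiff (1 : ℝ))^[j] P.eval 0),
    ← shift_eq_sum_fwdDiff_iter]
  simp

theorem abs_fwdDiff_iter_le {f : ℝ → ℝ} {B : ℝ} {j : ℕ} (hf : ∀ m : ℕ, m ≤ j → |f m| ≤ B) :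
    |(fwdDiff (1 : ℝ))^[j] f 0| ≤ 2 ^ j * B := by
  rw [fwdDiff_iter_eq_sum_shift]
  calc |∑ k ∈ range (j + 1), ((-1 : ℤ) ^ (j - k) * j.choose k) • f (0 + k • 1)|
      ≤ ∑ k ∈ range (j + 1), (j.choose k : ℝ) * B := by
        refine (abs_sum_le_sum_abs _ _).trans (sum_le_sum fun k hk => ?_)
        have := hf k (Nat.lt_succ_iff.1 (mem_range.1 hk))
        rw [zsmul_eq_mul, abs_mul]
        push_cast
        rw [abs_mul, abs_pow, abs_neg, abs_one, one_pow, one_mul, Nat.abs_cast, zero_add,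
          nsmul_one]
        gcongr
    _ = 2 ^ j * B := by
        rw [← sum_mul]
        exact_mod_cast congrArg (fun z : ℕ => (z : ℝ) * B) (Nat.sum_range_choose j)

/-- The monomial `∏_{i ∈ T} x_i` as a correlational statistical query. -/
noncomputable def monomialQuery {n : ℕ} (T : Finset (Fin n)) (x : Cube n) :
    Set.Icc (-1 : ℝ) 1 :=
  ⟨if ∀ i ∈ T, x i = true then 1 else 0, by split_ifs <;> norm_num⟩

theorem coe_monomialQuery {n : ℕ} (T : Finset (Fin n)) (x : Cube n) :
    (monomialQuery T x : ℝ) = if ∀ i ∈ T, x i = true then 1 else 0 := rfl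

/-- The sets of at most `d` variables, which index the monomials of degree at most `d`. -/
def lowDegreeSets (n d : ℕ) : Finset (Finset (Fin n)) := {T | #T ≤ d}

theorem card_lowDegreeSets_le (n d : ℕ) : #(lowDegreeSets n d) ≤ (n + 1) ^ d := by
  calc #(lowDegreeSets n d)
      ≤ #((range (d + 1)).biUnion fun j => powersetCard j (univ : Finset (Fin n))) := by
        refine card_le_card fun T hT => ?_
        simp only [lowDegreeSets, mem_filter, mem_univ, true_and] at hT
        simpa [mem_powersetCard, Nat.lt_succ_iff] using hT
    _ ≤ ∑ j ∈ range (d + 1), n.choose j := by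
        refine card_biUnion_le.trans_eq ?_
        simp [card_powersetCard]
    _ ≤ ∑ j ∈ range (d + 1), n ^ j * 1 ^ (d - j) * d.choose j := by
        refine sum_le_sum fun j hj => ?_
        rw [one_pow, mul_one]
        exact (Nat.choose_le_pow n j).trans (Nat.le_mul_of_pos_right _
          (Nat.choose_pos (Nat.lt_succ_iff.1 (mem_range.1 hj))))
    _ = (n + 1) ^ d := (add_pow n 1 d).symm

/-- The coefficient of a monomial depends only on its degree, and the same coefficients serve all
disjunctions: passing to another `S` only changes which monomials occur. -/
theorem exists_monomial_expansion_approx_disjunction {n r : ℕ} (hn : 0 < n) (hr : n ≤ r ^ 2)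
    (K : ℕ) :
    ∃ a : ℕ → ℝ, (∀ j ≤ n, |a j| ≤ 3 * 2 ^ (r * K)) ∧
      ∀ (S : Finset (Fin n)) (x : Cube n),
        |∑ T ∈ lowDegreeSets n (r * K), (if T ⊆ S then a #T else 0) * (monomialQuery T x : ℝ) -
          signedLabel (monotoneDisjunction S x)| ≤ 2 * (1 / 2) ^ K := by
  obtain ⟨P, hdeg, hP0, hP⟩ := exists_polynomial_approx_sign hn hr K
  set d := r * K
  have hvanish : ∀ j, d < j → (fwdDiff (1 : ℝ))^[j] P.eval 0 = 0 := fun j hj => by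
    rw [Polynomial.fwdDiff_iter_eq_zero_of_degree_lt (hdeg.trans_lt hj), Pi.zero_apply]
  have hbound : ∀ m : ℕ, m ≤ n → |P.eval (m : ℝ)| ≤ 3 := fun m hm => by
    rcases Nat.eq_zero_or_pos m with rfl | hm0
    · rw [Nat.cast_zero, hP0]
      norm_num
    · have h₁ := abs_le.1 (hP m hm0 hm)
      have h₂ : ((1 : ℝ) / 2) ^ K ≤ 1 := pow_le_one₀ (by norm_num) (by norm_num)
      rw [abs_le]
      constructor <;> linarith [h₁.1, h₁.2]
  refine ⟨fun j => (fwdDiff (1 : ℝ))^[j] P.eval 0, fun j hj => ?_, fun S x => ?_⟩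
  · rcases le_or_gt j d with hjd | hjd
    · refine (abs_fwdDiff_iter_le fun m hm => hbound m (hm.trans hj)).trans ?_
      rw [mul_comm]
      gcongr
      norm_num
    · simp only [hvanish j hjd, abs_zero]
      positivity
  · set s : Finset (Fin n) := S.filter fun i => x i = true with hs
    have hsum : ∑ T ∈ lowDegreeSets n d,
        (if T ⊆ S then (fwdDiff (1 : ℝ))^[#T] P.eval 0 else 0) * (monomialQuery T x : ℝ) =
          P.eval (#s : ℝ) := by
      rw [eval_card_eq_sum_powerset_fwdDiff, lowDegreeSets, sum_filter,
        ← sum_subset (subset_univ s.powerset)]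
      · refine sum_congr rfl fun T hT => ?_
        have hTs : ∀ i ∈ T, i ∈ S ∧ x i = true := fun i hi =>
          mem_filter.1 (mem_powerset.1 hT hi)
        have hTS : T ⊆ S := fun i hi => (hTs i hi).1
        rw [coe_monomialQuery, if_pos hTS, if_pos fun i hi => (hTs i hi).2, mul_one]
        split_ifs with h
        · rfl
        · exact (hvanish _ (not_le.1 h)).symm
      · intro T _ hT
        have : ¬ (T ⊆ S ∧ ∀ i ∈ T, x i = true) := fun h =>
          hT (mem_powerset.2 fun i hi => mem_filter.2 ⟨h.1 hi, h.2 i hi⟩)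
        rw [coe_monomialQuery]
        split_ifs <;> simp_all
    rw [hsum]
    rcases s.eq_empty_or_nonempty with he | hne
    · have hf : monotoneDisjunction S x = false := by
        simpa [monotoneDisjunction, hs, filter_eq_empty_iff] using he
      rw [hf, he, card_empty, Nat.cast_zero, hP0]
      simp [signedLabel]
    · have hf : monotoneDisjunction S x = true := by
        obtain ⟨i, hi⟩ := hne
        exact decide_eq_true ⟨i, mem_filter.1 hi⟩
      have hcard : #s ≤ n := (card_le_univ s).trans_eq (Fintype.card_fin n)
      rw [hf]
      convert hP #s hne.card_pos hcard using 3
      simp [signedLabel]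
      norm_num

end Approximation

section Correlation

/-! ### Correlations with the label -/

theorem sum_toReal_eq_one {n : ℕ} (D : PMF (Cube n × Bool)) : ∑ z, (D z).toReal = 1 := by
  rw [← ENNReal.toReal_sum fun z _ => D.apply_ne_top z, ← tsum_fintype (L := .unconditional _),
    D.tsum_coe, ENNReal.toReal_one]

/-- The expectation `E_{(x,y) ∼ D}[(2y-1) g(x)]` for an arbitrary real function `g`. -/
noncomputable def labelCorrelation {n : ℕ} (D : PMF (Cube n × Bool)) (g : Cube n → ℝ) : ℝ :=
  expectation D fun x y => signedLabel y * g x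

theorem misclassError_eq {n : ℕ} (D : PMF (Cube n × Bool)) (h : Cube n → Bool) :
    misclassError D h = 1 / 2 - labelCorrelation D (fun x => signedLabel (h x)) / 2 := by
  have key : ∀ z : Cube n × Bool, (D z).toReal * (if h z.1 ≠ z.2 then (1 : ℝ) else 0) =
      (D z).toReal * (1 / 2) -
        (D z).toReal * (signedLabel z.2 * signedLabel (h z.1)) * (1 / 2) := by
    rintro ⟨x, y⟩
    cases y <;> cases hx : h x <;> norm_num [signedLabel, hx] <;> ring
  rw [misclassError, labelCorrelation, expectation, expectation, sum_congr rfl fun z _ => key z,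
    sum_sub_distrib, ← sum_mul, ← sum_mul, sum_toReal_eq_one]
  ring

theorem labelCorrelation_sum {n : ℕ} {ι : Type*} (D : PMF (Cube n × Bool)) (s : Finset ι)
    (w : ι → ℝ) (g : ι → Cube n → ℝ) :
    labelCorrelation D (fun x => ∑ i ∈ s, w i * g i x) =
      ∑ i ∈ s, w i * labelCorrelation D (g i) := by
  simp only [labelCorrelation, expectation, mul_sum]
  rw [sum_comm]
  exact sum_congr rfl fun i _ => sum_congr rfl fun z _ => by ring

theorem abs_labelCorrelation_sub_le {n : ℕ} (D : PMF (Cube n × Bool)) {g₁ g₂ : Cube n → ℝ}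
    {η : ℝ} (h : ∀ x, |g₁ x - g₂ x| ≤ η) :
    |labelCorrelation D g₁ - labelCorrelation D g₂| ≤ η := by
  have hη : ∑ z : Cube n × Bool, (D z).toReal * η = η := by
    rw [← sum_mul, sum_toReal_eq_one, one_mul]
  rw [labelCorrelation, labelCorrelation, expectation, expectation, ← sum_sub_distrib, ← hη]
  refine (abs_sum_le_sum_abs _ _).trans (sum_le_sum fun z _ => ?_)
  have hy : |signedLabel z.2| = 1 := by cases z.2 <;> norm_num [signedLabel]
  rw [← mul_sub, ← mul_sub, abs_mul, abs_mul, hy, one_mul, abs_of_nonneg ENNReal.toReal_nonneg]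
  exact mul_le_mul_of_nonneg_left (h z.1) ENNReal.toReal_nonneg

end Correlation

section Learner

/-! ### The learner -/

namespace CSQAlgorithm

/-- The algorithm that asks the queries `φ i`, `i ∈ l`, one after the other and then outputs a
hypothesis computed from the answers. Answers are recorded as a function on all indices, which is
`0` where nothing was asked. -/
noncomputable def askAll {n : ℕ} {ι : Type*} [DecidableEq ι]
    (φ : ι → Cube n → Set.Icc (-1 : ℝ) 1) :
    List ι → ((ι → ℝ) → Cube n → Bool) → CSQAlgorithm n
  | [], out => output (out 0)
  | i :: l, out => query (φ i) fun a => askAll φ l fun v => out (Function.update v i a)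

theorem askAll_makesAtMost {n : ℕ} {ι : Type*} [DecidableEq ι]
    (φ : ι → Cube n → Set.Icc (-1 : ℝ) 1) (l : List ι) (out : (ι → ℝ) → Cube n → Bool) :
    (askAll φ l out).MakesAtMost l.length := by
  induction l generalizing out with
  | nil => trivial
  | cons i l ih => exact fun a => ih _

theorem exists_answers_of_askAll_canReturn {n : ℕ} {ι : Type*} [DecidableEq ι]
    {D : PMF (Cube n × Bool)} {τ : ℝ} {φ : ι → Cube n → Set.Icc (-1 : ℝ) 1} {l : List ι}
    {out : (ι → ℝ) → Cube n → Bool} {h : Cube n → Bool}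
    (hret : (askAll φ l out).CanReturn D τ h) :
    ∃ v : ι → ℝ, (∀ i ∈ l, |v i - correlation D (φ i)| ≤ τ) ∧ out v = h := by
  induction l generalizing out with
  | nil => exact ⟨0, by simp, hret⟩
  | cons i l ih =>
    obtain ⟨a, ha, hret⟩ := hret
    obtain ⟨v, hv, hout⟩ := ih hret
    refine ⟨Function.update v i a, fun j hj => ?_, hout⟩
    rcases eq_or_ne j i with rfl | hji
    · rw [Function.update_self]
      exact ha
    · rw [Function.update_of_ne hji]
      exact hv j ((List.mem_cons.1 hj).resolve_left hji)

end CSQAlgorithm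

/-- If monomial expansions with coefficients at most `W` approximate all disjunctions up to `η`,
then disjunctions can be learned agnostically up to `2 (η + τ M W)` in correlation, where `M` is
the number of monomials: output the disjunction with the largest estimated correlation. -/
theorem exists_learner_of_monomial_expansion {n d : ℕ} {a : ℕ → ℝ} {W η ε τ : ℝ}
    (ha : ∀ j ≤ n, |a j| ≤ W)
    (happrox : ∀ (S : Finset (Fin n)) (x : Cube n),
      |∑ T ∈ lowDegreeSets n d, (if T ⊆ S then a #T else 0) * (monomialQuery T x : ℝ) -
        signedLabel (monotoneDisjunction S x)| ≤ η)
    (hacc : η + #(lowDegreeSets n d) * (W * τ) ≤ ε / 2) :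
    ∃ A : CSQAlgorithm n, A.MakesAtMost #(lowDegreeSets n d) ∧
      ∀ D : PMF (Cube n × Bool),
        (∃ S : Finset (Fin n), misclassError D (monotoneDisjunction S) ≤ 1 / 2 - ε) →
        ∀ h : Cube n → Bool, A.CanReturn D τ h → misclassError D h ≤ 1 / 2 - ε / 2 := by
  let est : (Finset (Fin n) → ℝ) → Finset (Fin n) → ℝ := fun v S =>
    ∑ T ∈ lowDegreeSets n d, (if T ⊆ S then a #T else 0) * v T
  choose best hbest using fun v => exists_max_image univ (est v) univ_nonempty
  refine ⟨CSQAlgorithm.askAll monomialQuery (lowDegreeSets n d).toList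
    fun v => monotoneDisjunction (best v), ?_, ?_⟩
  · rw [← Finset.length_toList]
    exact CSQAlgorithm.askAll_makesAtMost _ _ _
  rintro D ⟨S₀, hS₀⟩ h hret
  obtain ⟨v, hv, rfl⟩ := CSQAlgorithm.exists_answers_of_askAll_canReturn hret
  have hW : 0 ≤ W := (abs_nonneg _).trans (ha 0 n.zero_le)
  have hest : ∀ S, |est v S -
      labelCorrelation D fun x => signedLabel (monotoneDisjunction S x)| ≤ ε / 2 := fun S => by
    have h₁ := abs_labelCorrelation_sub_le D (happrox S)
    rw [labelCorrelation_sum] at h₁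
    have h₂ : |est v S - ∑ T ∈ lowDegreeSets n d, (if T ⊆ S then a #T else 0) *
        labelCorrelation D fun x => (monomialQuery T x : ℝ)| ≤
          #(lowDegreeSets n d) * (W * τ) := by
      rw [← nsmul_eq_mul, ← sum_const, ← sum_sub_distrib]
      refine (abs_sum_le_sum_abs _ _).trans (sum_le_sum fun T hT => ?_)
      rw [← mul_sub, abs_mul]
      refine mul_le_mul ?_ (hv T (mem_toList.2 hT)) (abs_nonneg _) hW
      split_ifs
      · exact ha _ ((card_le_univ T).trans_eq (Fintype.card_fin n))
      · rwa [abs_zero]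
    refine (abs_sub_le _ _ _).trans ((add_le_add h₂ h₁).trans ?_)
    linarith
  have h₀ := abs_le.1 (hest S₀)
  have h₁ := abs_le.1 (hest (best v))
  have hmax := (hbest v).2 S₀ (mem_univ _)
  rw [misclassError_eq] at hS₀ ⊢
  linarith [h₀.1, h₁.2]

end Learner

section Complexity

/-! ### Choice of the parameters and complexity -/

theorem log_two_mul_succ_le {n : ℕ} (hn : 0 < n) {t : ℝ} (ht : Real.sqrt n / 2 ≤ t) :
    Real.log (2 * (n + 1)) ≤ 4 * Real.log (2 + t) := by
  have hs := Real.sqrt_nonneg (n : ℝ)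
  have hsq := Real.sq_sqrt (Nat.cast_nonneg (α := ℝ) n)
  have ht0 : 0 ≤ t := by linarith
  have h₁ : (n : ℝ) ≤ 4 * t ^ 2 := by nlinarith
  rw [show 4 * Real.log (2 + t) = Real.log ((2 + t) ^ 4) by rw [Real.log_pow]; norm_num]
  refine Real.log_le_log (by positivity) ?_
  have h₂ : (2 + t) ^ 4 = 16 + 32 * t + 24 * t ^ 2 + 8 * t ^ 3 + t ^ 4 := by ring
  have h₃ : 0 ≤ t ^ 3 := by positivity
  have h₄ : 0 ≤ t ^ 4 := by positivity
  rw [h₂]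
  linarith

theorem complexity_bound {n : ℕ} (hn : 0 < n) {ε : ℝ} (hε : 0 < ε) (hε2 : ε < 1 / 2) :
    12 * (2 * ((n : ℝ) + 1)) ^ (⌈Real.sqrt n⌉₊ * ⌈Real.logb 2 (8 / ε)⌉₊) / ε ≤
      (2 : ℝ) ^ (200 * timesPolylog 1 (Real.sqrt n * Real.log (1 / ε))) := by
  set r := ⌈Real.sqrt n⌉₊
  set K := ⌈Real.logb 2 (8 / ε)⌉₊
  set L := Real.log (1 / ε) with hL
  set s := Real.sqrt n
  set t := s * L with ht
  set l := Real.log (2 + t) with hl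
  have hlog2 := Real.log_two_gt_d9
  have hlog2' := Real.log_two_lt_d9
  have hs1 : 1 ≤ s := Real.one_le_sqrt.2 (by exact_mod_cast hn)
  have hL2 : Real.log 2 ≤ L :=
    Real.log_le_log (by norm_num) ((le_div_iff₀ hε).2 (by linarith))
  have hL0 : 0 < L := by linarith
  have hLt : L ≤ t := le_mul_of_one_le_left hL0.le hs1
  have hst : s / 2 ≤ t := by rw [ht]; nlinarith
  have hl2 : Real.log 2 ≤ l := Real.log_le_log (by norm_num) (by linarith)
  have htl : (0.69 : ℝ) * t ≤ t * l := by nlinarith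
  have hr : (r : ℝ) ≤ 2 * s := by
    have := Nat.ceil_lt_add_one (Real.sqrt_nonneg (n : ℝ))
    linarith
  have hK : (K : ℝ) ≤ 8 * L := by
    have h8 : Real.logb 2 (8 / ε) = 3 + L / Real.log 2 := by
      rw [div_eq_mul_one_div, Real.logb, Real.log_mul (by norm_num) (by positivity),
        show (8 : ℝ) = 2 ^ 3 by norm_num, Real.log_pow, ← hL]
      push_cast
      field_simp
    have h0 : 0 ≤ Real.logb 2 (8 / ε) := by rw [h8]; positivity
    have h₁ := Nat.ceil_lt_add_one h0
    have h₂ : L / Real.log 2 ≤ 3 / 2 * L := by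
      rw [div_le_iff₀ (by linarith)]
      nlinarith
    have h₃ : (K : ℝ) < Real.logb 2 (8 / ε) + 1 := h₁
    linarith
  have hd : ((r * K : ℕ) : ℝ) ≤ 16 * t := by
    push_cast
    calc (r : ℝ) * K ≤ (2 * s) * (8 * L) := by gcongr
      _ = 16 * t := by rw [ht]; ring
  have hn1 : Real.log (2 * ((n : ℝ) + 1)) ≤ 4 * l := log_two_mul_succ_le hn hst
  have hn0 : 0 ≤ Real.log (2 * ((n : ℝ) + 1)) :=
    Real.log_nonneg (by have : (0 : ℝ) ≤ n := n.cast_nonneg; linarith)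
  have h12 : Real.log 12 ≤ 4 * Real.log 2 := by
    rw [show 4 * Real.log 2 = Real.log (2 ^ 4) by rw [Real.log_pow]; norm_num]
    exact Real.log_le_log (by norm_num) (by norm_num)
  rw [Real.rpow_def_of_pos (by norm_num), ← Real.log_le_iff_le_exp (by positivity),
    div_eq_mul_one_div, Real.log_mul (by positivity) (by positivity),
    Real.log_mul (by positivity) (by positivity), Real.log_pow, ← hL, timesPolylog, pow_one, ← hl]
  have hmain : ((r * K : ℕ) : ℝ) * Real.log (2 * ((n : ℝ) + 1)) ≤ 64 * (t * l) := by
    calc _ ≤ (16 * t) * (4 * l) := mul_le_mul hd hn1 hn0 (by linarith)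
      _ = 64 * (t * l) := by ring
  have hrhs : 0.69 * (200 * (t * l)) ≤ Real.log 2 * (200 * (t * l)) := by
    refine mul_le_mul_of_nonneg_right (by linarith) ?_
    linarith
  linarith

theorem exists_agnostic_learner {n : ℕ} {ε : ℝ} (hε : 0 < ε) (hε2 : ε < 1 / 2) :
    ∃ (q : ℕ) (τ : ℝ) (A : CSQAlgorithm n), 0 < τ ∧
      max (q : ℝ) (1 / τ) ≤
        (2 : ℝ) ^ (200 * timesPolylog 1 (Real.sqrt n * Real.log (1 / ε))) ∧
      A.MakesAtMost q ∧
      ∀ D : PMF (Cube n × Bool),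
        (∃ S : Finset (Fin n), misclassError D (monotoneDisjunction S) ≤ 1 / 2 - ε) →
        ∀ h : Cube n → Bool, A.CanReturn D τ h → misclassError D h ≤ 1 / 2 - ε / 2 := by
  rcases Nat.eq_zero_or_pos n with rfl | hn
  -- Without variables the empty disjunction is the only one, and the bound leaves no room for a
  -- tolerance below `1`.
  · refine ⟨0, 1, .output (monotoneDisjunction ∅), one_pos, by simp [timesPolylog], trivial, ?_⟩
    rintro D ⟨S, hS⟩ h rfl
    rw [Subsingleton.elim S ∅] at hS
    linarith
  set r := ⌈Real.sqrt n⌉₊ with hr_def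
  set K := ⌈Real.logb 2 (8 / ε)⌉₊ with hK_def
  have hr : n ≤ r ^ 2 := by
    have h₁ : (n : ℝ) ≤ (r : ℝ) ^ 2 :=
      (Real.sqrt_le_left (Nat.cast_nonneg r)).1 (Nat.le_ceil _)
    exact_mod_cast h₁
  have hK : 2 * (1 / 2 : ℝ) ^ K ≤ ε / 4 := by
    have h₁ : 8 / ε ≤ (2 : ℝ) ^ K := by
      rw [← Real.rpow_natCast, ← Real.logb_le_iff_le_rpow (by norm_num) (by positivity)]
      exact Nat.le_ceil _
    rw [one_div, inv_pow, ← div_eq_mul_inv, div_le_iff₀ (by positivity)]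
    rw [div_le_iff₀ hε] at h₁
    linarith
  obtain ⟨a, ha, happrox⟩ := exists_monomial_expansion_approx_disjunction hn hr K
  set d := r * K with hd
  set M : ℕ := (n + 1) ^ d with hM
  have hM0 : (0 : ℝ) < M := by positivity
  have hcard : (#(lowDegreeSets n d) : ℝ) ≤ M := by exact_mod_cast card_lowDegreeSets_le n d
  have hbound := complexity_bound hn hε hε2
  rw [← hr_def, ← hK_def, ← hd, mul_pow] at hbound
  -- The tolerance makes the weighted sum of the answers' errors at most `ε / 4`.
  set τ : ℝ := ε / (4 * (M * (3 * 2 ^ d))) with hτ_def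
  have hτ : 0 < τ := by positivity
  have hacc : 2 * (1 / 2 : ℝ) ^ K + #(lowDegreeSets n d) * (3 * 2 ^ d * τ) ≤ ε / 2 := by
    have h₁ : (#(lowDegreeSets n d) : ℝ) * (3 * 2 ^ d * τ) ≤ M * (3 * 2 ^ d * τ) := by gcongr
    have h₂ : (M : ℝ) * (3 * 2 ^ d * τ) = ε / 4 := by
      rw [hτ_def]
      field_simp
    linarith
  obtain ⟨A, hA, hlearn⟩ := exists_learner_of_monomial_expansion ha happrox hacc
  have hinv : 1 / τ = 12 * (2 ^ d * ((n : ℝ) + 1) ^ d) / ε := by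
    rw [hτ_def, hM]
    push_cast
    field_simp
    norm_num
  refine ⟨_, τ, A, hτ, max_le (le_trans ?_ hbound) (hinv.trans_le hbound), hA, hlearn⟩
  have h₃ : (M : ℝ) = ((n : ℝ) + 1) ^ d := by rw [hM]; push_cast; rfl
  rw [← h₃, le_div_iff₀ hε]
  have h₄ : (1 : ℝ) ≤ 2 ^ d := one_le_pow₀ (by norm_num)
  calc (#(lowDegreeSets n d) : ℝ) * ε ≤ M * 1 := by gcongr; linarith
    _ ≤ 12 * (2 ^ d * M) := by nlinarith

end Complexity

theorem mainTheorem7 :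
    ∃ (c C : ℝ) (k : ℕ), 0 < c ∧ 0 < C ∧
      ∃ (q : ℕ → ℝ → ℕ) (τ : ℕ → ℝ → ℝ) (A : (n : ℕ) → ℝ → CSQAlgorithm n),
        ∀ (n : ℕ) (ε : ℝ), 0 < ε → ε < 1 / 2 →
          0 < τ n ε ∧
          max (q n ε : ℝ) (1 / τ n ε) ≤
            (2 : ℝ) ^ (C * timesPolylog k (Real.sqrt n * Real.log (1 / ε))) ∧
          (A n ε).MakesAtMost (q n ε) ∧
          ∀ D : PMF (Cube n × Bool),
            (∃ S : Finset (Fin n), misclassError D (monotoneDisjunction S) ≤ 1 / 2 - ε) →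
            ∀ h : Cube n → Bool, (A n ε).CanReturn D (τ n ε) h →
              misclassError D h ≤ 1 / 2 - c * ε := by
  -- Outside `0 < ε < 1/2` nothing is required, so the parameters may be chosen arbitrarily there.
  have key : ∀ (n : ℕ) (ε : ℝ), ∃ (q : ℕ) (τ : ℝ) (A : CSQAlgorithm n),
      0 < ε → ε < 1 / 2 → 0 < τ ∧
        max (q : ℝ) (1 / τ) ≤
          (2 : ℝ) ^ (200 * timesPolylog 1 (Real.sqrt n * Real.log (1 / ε))) ∧
        A.MakesAtMost q ∧
        ∀ D : PMF (Cube n × Bool),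
          (∃ S : Finset (Fin n), misclassError D (monotoneDisjunction S) ≤ 1 / 2 - ε) →
          ∀ h : Cube n → Bool, A.CanReturn D τ h → misclassError D h ≤ 1 / 2 - 1 / 2 * ε := by
    intro n ε
    by_cases hε : 0 < ε ∧ ε < 1 / 2
    · obtain ⟨q, τ, A, h₁, h₂, h₃, h₄⟩ := exists_agnostic_learner (n := n) hε.1 hε.2
      refine ⟨q, τ, A, fun _ _ => ⟨h₁, h₂, h₃, fun D hD h hh => ?_⟩⟩
      linarith [h₄ D hD h hh]
    · exact ⟨0, 0, .output fun _ => false, fun h₁ h₂ => absurd ⟨h₁, h₂⟩ hε⟩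
  choose q τ A h using key
  exact ⟨1 / 2, 200, 1, by norm_num, by norm_num, q, τ, A, h⟩
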